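/- A modal algebra is a Boolean algebra $A$ with an operation $\square$ such that $\square 1=1$ and $\square(a\wedge b)=\square a\wedge\square b$; it is a Magari algebra if moreover $\square(\neg\square a\vee a)=\square a$ for all $a\in A$. Write $\square^+a:=\square a\wedge a$. A fronton is a Heyting algebra $H$ with an operation $\boxtimes$ such that, for all $a,b\in H$, $\boxtimes 1=1$, $\boxtimes(a\wedge b)=\boxtimes a\wedge\boxtimes b$, $a\le\boxtimes a$, $\boxtimes a\to a=a$ and $\boxtimes a\le b\vee(b\to a)$. For a Magari algebra $A$ let $\rho A$ be the fronton on $\{a\in A:\square^+a=a\}$ with the lattice operations of $A$, $a\to b:=\square^+(\neg a\vee b)$ and $\boxtimes a:=\square a$. For a fronton $H$ let $\sigma H$ be the Magari algebra on the free Boolean extension $B(H)$ of $H$ with $\square a:=\boxtimes Ia$, where $Ia:=\bigvee\{b\in H:b\le a\}$. A Magari algebra $A$ is skeletal if $\sigma\rho A\cong A$. A class of Magari algebras is universal if it is axiomatised, within the class of all Magari algebras, by a set of universal first-order sentences; $\mathsf{Uni}(\mathcal K)$ is the least universal class of Magari algebras containing $\mathcal K$. For a class $\mathcal W$ of Magari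 algebras put $\rho\mathcal W:=\{\rho A:A\in\mathcal W\}$ (up to isomorphism), and for a class $\mathcal V$ of frontons put $\sigma\mathcal V:=\mathsf{Uni}\{\sigma H:H\in\mathcal V\}$. A modal rule $\Gamma/\Delta$ is a pair of finite sets of modal formulae over a countably infinite set of variables; it is valid on $A$ if every valuation on $A$ that gives all members of $\Gamma$ the value $1$ gives some member of $\Delta$ the value $1$. Theorem. (1) Every universal class $\mathcal U$ of Magari algebras is generated by its skeletal elements, that is, $\mathcal U=\mathsf{Uni}\{A\in\mathcal U: A\text{ skeletal}\}$, and $\mathcal U=\sigma\rho\,\mathcal U$. (2) For every Magari algebra $A$ and every modal rule $\Gamma/\Delta$, $\Gamma/\Delta$ is valid on $A$ if and only if it is valid on $\sigma\rho A$. -/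

import Mathlib

universe u

namespace KM

/-! ### Modal algebras, Magari algebras and frontons -/

/-- A modal algebra: a Boolean algebra with a unary operation preserving `1` and binary meets. -/
class ModalAlgebra (A : Type u) extends BooleanAlgebra A where
  box : A → A
  box_top : box ⊤ = ⊤
  box_inf : ∀ a b : A, box (a ⊓ b) = box a ⊓ box b

/-- A Magari algebra: a modal algebra with `□(□a → a) = □a`, where `x → y` is `¬x ∨ y`. -/
class MagariAlgebra (A : Type u) extends ModalAlgebra A where
  box_loeb : ∀ a : A, box ((box a)ᶜ ⊔ a) = box a

/-- A fronton: a Heyting algebra with a unary operation `⊠` (written `bx`) such that `⊠1 = 1`,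
`⊠(a ∧ b) = ⊠a ∧ ⊠b`, `a ≤ ⊠a`, `⊠a → a = a` and `⊠a ≤ b ∨ (b → a)`. -/
class Fronton (H : Type u) extends HeytingAlgebra H where
  bx : H → H
  bx_top : bx ⊤ = ⊤
  bx_inf : ∀ a b : H, bx (a ⊓ b) = bx a ⊓ bx b
  le_bx : ∀ a : H, a ≤ bx a
  bx_himp : ∀ a : H, bx a ⇨ a = a
  bx_le : ∀ a b : H, bx a ≤ b ⊔ (b ⇨ a)

/-- The class of all Magari algebras (with carrier in a fixed universe). -/
structure Mag where
  carrier : Type u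
  [str : MagariAlgebra carrier]

/-- The class of all frontons (with carrier in a fixed universe). -/
structure Frt where
  carrier : Type u
  [str : Fronton carrier]

attribute [instance] Mag.str Frt.str

open ModalAlgebra (box)
open Fronton (bx)

/-- Isomorphism of Magari algebras (order isomorphisms preserve all the Boolean operations). -/
def Mag.Iso (A B : Mag.{u}) : Prop :=
  ∃ e : A.carrier ≃o B.carrier, ∀ a, e (box a) = box (e a)

/-- Isomorphism of frontons (order isomorphisms preserve all the Heyting operations). -/
def Frt.Iso (H K : Frt.{u}) : Prop :=
  ∃ e : H.carrier ≃o K.carrier, ∀ a, e (bx a) = bx (e a)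

section Basic

variable {A : Type u}

theorem box_mono [ModalAlgebra A] {a b : A} (h : a ≤ b) : box a ≤ box b := by
  have := ModalAlgebra.box_inf a b
  rw [inf_eq_left.2 h] at this
  rw [this]
  exact inf_le_right

/-- `□⁺a := □a ∧ a`. -/
def boxPlus [ModalAlgebra A] (a : A) : A := box a ⊓ a

theorem boxPlus_eq_iff [ModalAlgebra A] {a : A} : boxPlus a = a ↔ a ≤ box a := inf_eq_right

theorem box_le_box_box [MagariAlgebra A] (a : A) : box a ≤ box (box a) := by
  have hy : box (box a ⊓ a) = box (box a) ⊓ box a := ModalAlgebra.box_inf _ _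
  have h1 : a ≤ (box (box a ⊓ a))ᶜ ⊔ (box a ⊓ a) := by
    rw [sup_comm, ← himp_eq, le_himp_iff, hy]
    exact le_inf (inf_le_right.trans inf_le_right) inf_le_left
  calc box a ≤ _ := box_mono h1
    _ = box (box a ⊓ a) := MagariAlgebra.box_loeb _
    _ ≤ box (box a) := by rw [hy]; exact inf_le_left

end Basic

/-! ### The fronton `ρA` of a Magari algebra `A` -/

/-- `O(A) = {a ∈ A : □⁺a = a}`. -/
def Opens (A : Type u) [MagariAlgebra A] : Type u := {a : A // boxPlus a = a}

namespace Opens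

variable {A : Type u} [MagariAlgebra A]

theorem sup_open ⦃a b : A⦄ (ha : boxPlus a = a) (hb : boxPlus b = b) :
    boxPlus (a ⊔ b) = a ⊔ b := by
  rw [boxPlus_eq_iff] at *
  exact sup_le (ha.trans (box_mono le_sup_left)) (hb.trans (box_mono le_sup_right))

theorem inf_open ⦃a b : A⦄ (ha : boxPlus a = a) (hb : boxPlus b = b) :
    boxPlus (a ⊓ b) = a ⊓ b := by
  rw [boxPlus_eq_iff] at *
  rw [ModalAlgebra.box_inf]
  exact inf_le_inf ha hb

theorem boxPlus_open (a : A) : boxPlus (boxPlus a) = boxPlus a := by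
  rw [boxPlus_eq_iff, boxPlus, ModalAlgebra.box_inf]
  exact le_inf (inf_le_left.trans (box_le_box_box a)) inf_le_left

theorem box_open (a : A) : boxPlus (box a) = box a := boxPlus_eq_iff.2 (box_le_box_box a)

theorem top_open : boxPlus (⊤ : A) = ⊤ := by rw [boxPlus_eq_iff, ModalAlgebra.box_top]

theorem bot_open : boxPlus (⊥ : A) = ⊥ := boxPlus_eq_iff.2 bot_le

theorem le_boxPlus_iff {a b : A} (ha : boxPlus a = a) : a ≤ boxPlus b ↔ a ≤ b := by
  refine ⟨fun h => h.trans inf_le_right, fun h => le_inf ?_ h⟩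
  exact (boxPlus_eq_iff.1 ha).trans (box_mono h)

/-- `O(A)` with the lattice operations of `A` and `a → b := □⁺(¬a ∨ b)`. -/
instance heyting : HeytingAlgebra (Opens A) where
  __ := (Subtype.lattice sup_open inf_open : Lattice {a : A // boxPlus a = a})
  top := ⟨⊤, top_open⟩
  le_top a := (le_top : a.1 ≤ ⊤)
  bot := ⟨⊥, bot_open⟩
  bot_le a := (bot_le : ⊥ ≤ a.1)
  himp a b := ⟨boxPlus (a.1ᶜ ⊔ b.1), boxPlus_open _⟩
  le_himp_iff a b c := by
    change a.1 ≤ boxPlus (b.1ᶜ ⊔ c.1) ↔ a.1 ⊓ b.1 ≤ c.1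
    rw [le_boxPlus_iff a.2, sup_comm, ← himp_eq, le_himp_iff]
  compl a := ⟨boxPlus (a.1ᶜ ⊔ ⊥), boxPlus_open _⟩
  himp_bot _ := rfl

/-- `ρA`: the Heyting algebra `O(A)` with `⊠a := □a`. -/
instance fronton : Fronton (Opens A) where
  bx a := ⟨box a.1, box_open a.1⟩
  bx_top := Subtype.ext ModalAlgebra.box_top
  bx_inf a b := Subtype.ext (ModalAlgebra.box_inf a.1 b.1)
  le_bx a := boxPlus_eq_iff.1 a.2
  bx_himp a := Subtype.ext <| by
    change boxPlus ((box a.1)ᶜ ⊔ a.1) = a.1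
    rw [boxPlus, MagariAlgebra.box_loeb, inf_sup_left, inf_compl_self, bot_sup_eq]
    exact a.2
  bx_le a b := by
    change box a.1 ≤ b.1 ⊔ boxPlus (b.1ᶜ ⊔ a.1)
    rw [boxPlus, sup_inf_left, ← sup_assoc b.1, sup_compl_eq_top, top_sup_eq, inf_top_eq]
    exact (box_mono le_sup_right).trans le_sup_right

end Opens

/-- The map `ρ` from Magari algebras to frontons. -/
def rho (A : Mag.{u}) : Frt.{u} := ⟨Opens A.carrier⟩

/-! ### The free Boolean extension and the Magari algebra `σH` of a fronton `H` -/

section FreeBoolean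

variable (H : Type u) [HeytingAlgebra H]

/-- The prime ideals of `H`. -/
def PrimeIdeals : Type u := {I : Order.Ideal H // I.IsPrime}

variable {H}

/-- The Stone map `a ↦ {I : a ∉ I}` from `H` to the sets of prime ideals. -/
def stone (a : H) : Set (PrimeIdeals H) := {I | a ∉ I.1}

theorem stone_top : stone (⊤ : H) = ⊤ := by
  ext I
  have := I.2
  simpa [stone] using I.2.toIsProper.top_notMem

theorem stone_bot : stone (⊥ : H) = ⊥ := by
  ext I
  simp [stone]

theorem stone_inf (a b : H) : stone (a ⊓ b) = stone a ⊓ stone b := by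
  ext I
  change a ⊓ b ∉ I.1 ↔ a ∉ I.1 ∧ b ∉ I.1
  refine ⟨fun h => ⟨fun ha => h (I.1.lower inf_le_left ha),
    fun hb => h (I.1.lower inf_le_right hb)⟩, fun h hab => ?_⟩
  exact (I.2.mem_or_mem hab).elim h.1 h.2

theorem stone_sup (a b : H) : stone (a ⊔ b) = stone a ⊔ stone b := by
  ext I
  change a ⊔ b ∉ I.1 ↔ a ∉ I.1 ∨ b ∉ I.1
  rw [Order.Ideal.sup_mem_iff, not_and_or]

theorem stone_le_stone {a b : H} : stone a ≤ stone b ↔ a ≤ b := by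
  refine ⟨fun h => ?_, fun h I ha hb => ha (I.1.lower h hb)⟩
  by_contra hab
  have hd : Disjoint (Order.PFilter.principal a : Set H) (Order.Ideal.principal b : Set H) := by
    rw [Set.disjoint_left]
    intro x hx hx'
    exact hab ((Order.PFilter.mem_principal.1 hx).trans (Order.Ideal.mem_principal.1 hx'))
  obtain ⟨J, hJ, hbJ, haJ⟩ := DistribLattice.prime_ideal_of_disjoint_filter_ideal hd
  refine h (a := ⟨J, hJ⟩) ?_ (hbJ (Order.Ideal.mem_principal.2 le_rfl))
  exact fun ha => Set.disjoint_left.1 haJ (Order.PFilter.mem_principal.2 le_rfl) ha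

variable (H)

/-- The free Boolean extension `B(H)` of `H`: the Boolean algebra of sets of prime ideals generated
by the isomorphic copy `{stone a : a ∈ H}` of the lattice `H`. -/
def FreeBoolExt : Type u := BooleanSubalgebra.closure (Set.range (stone (H := H)))

instance : BooleanAlgebra (FreeBoolExt H) :=
  inferInstanceAs (BooleanAlgebra (BooleanSubalgebra.closure (Set.range (stone (H := H)))))

variable {H}

/-- The embedding of `H` into its free Boolean extension. -/
def emb (a : H) : FreeBoolExt H := ⟨stone a, BooleanSubalgebra.subset_closure ⟨a, rfl⟩⟩

theorem emb_le_emb {a b : H} : emb a ≤ emb b ↔ a ≤ b := stone_le_stone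

theorem emb_top : emb (⊤ : H) = ⊤ := Subtype.ext stone_top

theorem emb_inf (a b : H) : emb (a ⊓ b) = emb a ⊓ emb b := Subtype.ext (stone_inf a b)

theorem exists_isGreatest (x : FreeBoolExt H) : ∃ h : H, IsGreatest {b : H | emb b ≤ x} h := by
  suffices key : ∀ s ∈ BooleanSubalgebra.closure (Set.range (stone (H := H))),
      ∃ h : H, ∀ b : H, stone b ≤ sᶜ ↔ b ≤ h by
    obtain ⟨h, hh⟩ := key x.1ᶜ (BooleanSubalgebra.compl_mem x.2)
    rw [compl_compl] at hh
    exact ⟨h, (hh h).2 le_rfl, fun b hb => (hh b).1 hb⟩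
  have hsub : IsSublattice (Set.range (stone (H := H))) := by
    refine ⟨?_, ?_⟩
    · rintro _ ⟨a, rfl⟩ _ ⟨b, rfl⟩
      exact ⟨a ⊔ b, stone_sup a b⟩
    · rintro _ ⟨a, rfl⟩ _ ⟨b, rfl⟩
      exact ⟨a ⊓ b, stone_inf a b⟩
  intro s hs
  induction s, hs using BooleanSubalgebra.closure_sdiff_sup_induction hsub
    ⟨⊥, stone_bot⟩ ⟨⊤, stone_top⟩ with
  | sdiff x hx y hy =>
    obtain ⟨a, rfl⟩ := hx
    obtain ⟨c, rfl⟩ := hy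
    refine ⟨a ⇨ c, fun b => ?_⟩
    rw [le_himp_iff, compl_sdiff, ← stone_le_stone (a := b ⊓ a) (b := c), stone_inf]
    exact le_himp_iff
  | sup x hx y hy ihx ihy =>
    obtain ⟨h₁, ih₁⟩ := ihx
    obtain ⟨h₂, ih₂⟩ := ihy
    exact ⟨h₁ ⊓ h₂, fun b => by rw [compl_sup, le_inf_iff, le_inf_iff, ih₁, ih₂]⟩

/-- `Ix := ⋁ {b ∈ H : b ≤ x}`, the greatest element of `H` below `x ∈ B(H)`. -/
noncomputable def interior (x : FreeBoolExt H) : H := (exists_isGreatest x).choose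

theorem le_interior_iff {b : H} {x : FreeBoolExt H} : b ≤ interior x ↔ emb b ≤ x :=
  ⟨fun h => (emb_le_emb.2 h).trans (exists_isGreatest x).choose_spec.1,
    fun h => (exists_isGreatest x).choose_spec.2 h⟩

end FreeBoolean

/-- `σH`: the free Boolean extension of `H` with `□x := ⊠(Ix)`. -/
noncomputable instance sigmaMagari (H : Type u) [Fronton H] : MagariAlgebra (FreeBoolExt H) where
  box x := emb (bx (interior x))
  box_top := by
    have : interior (⊤ : FreeBoolExt H) = ⊤ := top_le_iff.1 (le_interior_iff.2 le_top)
    rw [this, Fronton.bx_top, emb_top]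
  box_inf x y := by
    have : interior (x ⊓ y) = interior x ⊓ interior y :=
      eq_of_forall_le_iff fun b => by
        rw [le_inf_iff, le_interior_iff, le_interior_iff, le_interior_iff, le_inf_iff]
    rw [this, Fronton.bx_inf, emb_inf]
  box_loeb x := by
    congr 2
    refine le_antisymm ?_ ?_
    · rw [← Fronton.bx_himp (interior x), le_himp_iff, le_interior_iff, emb_inf,
        Fronton.bx_himp (interior x), ← le_himp_iff, himp_eq, sup_comm]
      exact le_interior_iff.1 le_rfl
    · exact le_interior_iff.2 ((le_interior_iff.1 le_rfl).trans le_sup_right)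

/-- The map `σ` from frontons to Magari algebras. -/
noncomputable def sigma (H : Frt.{u}) : Mag.{u} := ⟨FreeBoolExt H.carrier⟩

/-- A Magari algebra `A` is skeletal if `σρA ≅ A`. -/
def Mag.IsSkeletal (A : Mag.{u}) : Prop := (sigma (rho A)).Iso A

/-! ### Universal classes and rules -/

/-- The operation symbols of the modal signature. -/
inductive MdOp : ℕ → Type
  | and : MdOp 2
  | or : MdOp 2
  | neg : MdOp 1
  | box : MdOp 1
  | bot : MdOp 0
  | top : MdOp 0

/-- The modal signature, as a first-order language without relation symbols. -/
def md : FirstOrder.Language.{0, 0} := ⟨MdOp, fun _ => Empty⟩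

/-- The operation of a modal algebra named by an operation symbol. -/
def interpOp {A : Type u} [ModalAlgebra A] : {n : ℕ} → MdOp n → (Fin n → A) → A
  | _, .and, v => v 0 ⊓ v 1
  | _, .or, v => v 0 ⊔ v 1
  | _, .neg, v => (v 0)ᶜ
  | _, .box, v => box (v 0)
  | _, .bot, _ => ⊥
  | _, .top, _ => ⊤

instance mdStructure (A : Type u) [ModalAlgebra A] : md.Structure A where
  funMap f v := interpOp f v
  RelMap r _ := r.elim

/-- A class of Magari algebras is universal if it is axiomatised, within the Magari algebras, by a
set of universal first-order sentences in the modal signature. -/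
def IsUniversalClass (U : Set Mag.{u}) : Prop :=
  ∃ T : md.Theory, T.IsUniversal ∧ U = {A : Mag.{u} | A.carrier ⊨ T}

/-- `Uni(K)`: the universal class generated by `K`, the least universal class containing `K`. -/
def Uni (K : Set Mag.{u}) : Set Mag.{u} :=
  {A | ∀ W : Set Mag.{u}, IsUniversalClass W → K ⊆ W → A ∈ W}

/-- `ρ` on classes: `{ρA : A ∈ W}` (as a class closed under isomorphism). -/
def rhoClass (W : Set Mag.{u}) : Set Frt.{u} := {H | ∃ A ∈ W, (rho A).Iso H}

/-- `σ` on classes: `Uni {σH : H ∈ V}`. -/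
def sigmaClass (V : Set Frt.{u}) : Set Mag.{u} := Uni {B | ∃ H ∈ V, B = sigma H}

/-- Modal formulae: the terms of the modal signature over countably many variables. -/
abbrev MdFormula : Type := md.Term ℕ

/-- A multi-conclusion modal rule `Γ/Δ`, with `Γ` and `Δ` finite sets of modal formulae. -/
structure MdRule where
  premises : Finset MdFormula
  conclusions : Finset MdFormula

/-- `Γ/Δ` is valid on `A`: every valuation giving all formulae in `Γ` the value `1` gives some
formula in `Δ` the value `1`. -/
def Valid (A : Mag.{u}) (r : MdRule) : Prop :=
  ∀ V : ℕ → A.carrier, (∀ γ ∈ r.premises, γ.realize V = ⊤) →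
    ∃ δ ∈ r.conclusions, δ.realize V = ⊤

end KM

universe v

namespace KM

open ModalAlgebra (box)
open Fronton (bx)

/-! ### Finite partitions -/

section Partition

/-! Everything reduces to `A` and `σρA` embedding locally (every finite part at a time) into each
other, since universal sentences and rules only test finite parts. The inclusion of the opens
extends to an embedding of `σρA` into `A`, with image the Boolean subalgebra generated by the opens
(`lift_box`).

For the converse, let `L` be a Boolean subalgebra containing all opens, and `F` finite. Partition
`A` into cells `b i` deciding every `d` and `□d` with `d ∈ F`, and replace them by cells `p i ∈ L`.
By Löb's axiom, whether a point sees `b i` depends only on the maximal part `b i ∧ □¬b i`, which is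
a difference of opens and so lies in `L`. If `p i` contains that part and stays below `b i ∨ ◇b i`,
where `◇a = ¬□¬a`, then `□¬p i = □¬b i`. Keeping `p i` on the same side of each `□d` as `b i`, the
map sending `a` to the join of the `p i` with `b i ≤ a` preserves the operations on `F`
(`exists_skeletal_partition`, `exists_preservesOn_mem`).

Finally `σH` is always skeletal, because the fronton axioms make its opens exactly the copy of `H`
(`boxPlus_eq_iff_mem_range_emb`). -/

theorem exists_partition_deciding {A : Type u} [BooleanAlgebra A] (G : Finset A) :
    ∃ (ι : Type) (_ : Fintype ι) (b : ι → A), (∀ i j, i ≠ j → Disjoint (b i) (b j)) ∧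
      (∀ x, (∀ i, b i ≤ x) → x = ⊤) ∧ ∀ g ∈ G, ∀ i, b i ≤ g ∨ Disjoint (b i) g := by
  classical
  induction G using Finset.induction_on with
  | empty =>
    exact ⟨Unit, inferInstance, fun _ => ⊤, fun i j h => absurd (Subsingleton.elim i j) h,
      fun x hx => top_le_iff.1 (hx ()), by simp⟩
  | insert g G _ ih =>
    obtain ⟨ι, _, b, hd, hc, hG⟩ := ih
    -- Splitting may create empty cells; they are kept, and treated separately below.
    refine ⟨ι × Bool, inferInstance, fun i => b i.1 ⊓ bif i.2 then g else gᶜ, ?_, ?_, ?_⟩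
    · rintro ⟨i, s⟩ ⟨j, t⟩ hij
      by_cases h : i = j
      · subst h
        have hg : Disjoint (b i ⊓ g) (b i ⊓ gᶜ) :=
          disjoint_compl_right.mono inf_le_right inf_le_right
        cases s <;> cases t <;> first | exact absurd rfl hij | exact hg | exact hg.symm
      · exact (hd i j h).mono inf_le_left inf_le_left
    · refine fun x hx => hc x fun i => ?_
      have h := sup_le (hx (i, true)) (hx (i, false))
      rwa [← inf_sup_left, cond_true, cond_false, sup_compl_eq_top, inf_top_eq] at h
    · rintro a ha ⟨i, s⟩
      rcases Finset.mem_insert.1 ha with rfl | ha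
      · cases s
        · exact Or.inr (disjoint_compl_left.mono_left inf_le_right)
        · exact Or.inl inf_le_right
      · exact (hG a ha i).imp inf_le_left.trans fun h => h.mono_left inf_le_left

end Partition

/-! ### Maximal parts and partitions inside a subalgebra containing the opens -/

section Maximal

variable {A : Type u}

/-- `a ∧ □¬a`, dual to the set of maximal points of a clopen set. -/
def maxPart [ModalAlgebra A] (a : A) : A := a ⊓ box aᶜ

theorem maxPart_le [ModalAlgebra A] (a : A) : maxPart a ≤ a := inf_le_left

variable [MagariAlgebra A]

/-- Löb's axiom for `aᶜ`: dually, a point that sees `a` sees a maximal point of `a`. -/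
theorem box_compl_maxPart (a : A) : box (maxPart a)ᶜ = box aᶜ := by
  rw [maxPart, compl_inf, sup_comm, MagariAlgebra.box_loeb]

theorem maxPart_eq_bot {a : A} (h : maxPart a = ⊥) : a = ⊥ := by
  have h1 : box aᶜ = ⊤ := by rw [← box_compl_maxPart, h, compl_bot, ModalAlgebra.box_top]
  rwa [maxPart, h1, inf_top_eq] at h

/-- Although `a` is arbitrary, `a ∧ □¬a` is the difference of the opens `□¬a` and `□⁺¬a`. -/
theorem maxPart_mem {L : BooleanSubalgebra A} (hL : ∀ a, boxPlus a = a → a ∈ L) (a : A) :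
    maxPart a ∈ L := by
  have h : maxPart a = box aᶜ ⊓ (boxPlus aᶜ)ᶜ := by
    rw [boxPlus, compl_inf, compl_compl, inf_sup_left, inf_compl_self, bot_sup_eq, maxPart,
      inf_comm]
  rw [h]
  exact BooleanSubalgebra.infClosed _ (hL _ (Opens.box_open _))
    (BooleanSubalgebra.compl_mem (hL _ (Opens.boxPlus_open _)))

/-- The lower bound on `p` suffices for one inequality by Löb's axiom, the upper bound for the other
by transitivity. -/
theorem box_compl_eq_of_le {a p : A} (h : maxPart a ≤ p) (h' : p ≤ a ⊔ (box aᶜ)ᶜ) :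
    box pᶜ = box aᶜ := by
  refine le_antisymm ((box_mono (compl_le_compl h)).trans (box_compl_maxPart a).le) ?_
  have h1 := box_mono (compl_le_compl h')
  rw [compl_sup, compl_compl, ModalAlgebra.box_inf] at h1
  exact (le_inf le_rfl (box_le_box_box _)).trans h1

theorem finset_inf_mem {B : Type*} [BooleanAlgebra B] {ι : Type*} (L : BooleanSubalgebra B)
    (s : Finset ι) (f : ι → B) (h : ∀ i ∈ s, f i ∈ L) : s.inf f ∈ L :=
  Finset.inf_induction BooleanSubalgebra.top_mem (fun _ ha _ hb => L.infClosed ha hb) h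

theorem finset_sup_mem {B : Type*} [BooleanAlgebra B] {ι : Type*} (L : BooleanSubalgebra B)
    (s : Finset ι) (f : ι → B) (h : ∀ i ∈ s, f i ∈ L) : s.sup f ∈ L :=
  Finset.sup_induction BooleanSubalgebra.bot_mem (fun _ ha _ hb => L.supClosed ha hb) h

/-- The maximal parts already lie in `L`. What they leave uncovered is covered by elements `c i ∈ L`
obeying the required upper bounds, and is shared out among the cells. -/
theorem exists_skeletal_partition {L : BooleanSubalgebra A} (hL : ∀ a, boxPlus a = a → a ∈ L)
    {ι : Type} [Fintype ι] {b : ι → A} (hd : ∀ i j, i ≠ j → Disjoint (b i) (b j))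
    (hc : ∀ x, (∀ i, b i ≤ x) → x = ⊤) (F : Finset A)
    (hF : ∀ d ∈ F, ∀ i, b i ≤ box d ∨ Disjoint (b i) (box d)) :
    ∃ p : ι → A, (∀ i, p i ∈ L) ∧ (∀ i j, i ≠ j → Disjoint (p i) (p j)) ∧
      (∀ x, (∀ i, p i ≤ x) → x = ⊤) ∧ (∀ i, maxPart (b i) ≤ p i) ∧
      (∀ i, p i ≤ b i ⊔ (box (b i)ᶜ)ᶜ) ∧
      ∀ d ∈ F, ∀ i, (b i ≤ box d → p i ≤ box d) ∧
        (Disjoint (b i) (box d) → Disjoint (p i) (box d)) := by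
  classical
  set y : A := (Finset.univ.sup fun i => maxPart (b i))ᶜ with hy
  have hyL : y ∈ L :=
    BooleanSubalgebra.compl_mem (finset_sup_mem _ _ _ fun i _ => maxPart_mem hL _)
  -- `t i d` is the side of `box d` on which `b i` lies, so `c i` is the largest element allowed for
  -- the non-maximal part of `p i`.
  set t : ι → A → A := fun i d => if b i ≤ box d then box d else (box d)ᶜ with ht
  set c : ι → A := fun i => (box (b i)ᶜ)ᶜ ⊓ F.inf (t i) with hcdef
  have hcL : ∀ i, c i ∈ L := fun i => by
    refine L.infClosed (BooleanSubalgebra.compl_mem (hL _ (Opens.box_open _)))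
      (finset_inf_mem _ _ _ fun d _ => ?_)
    have := hL _ (Opens.box_open d)
    simp only [ht]
    split_ifs
    exacts [this, BooleanSubalgebra.compl_mem this]
  have hbt : ∀ i, ∀ d ∈ F, b i ≤ t i d := fun i d hdF => by
    simp only [ht]
    split_ifs with h
    · exact h
    · exact ((hF d hdF i).resolve_left h).le_compl_right
  -- The `c i` may overlap; they are made disjoint inside `L`, so that the pieces stay in `L`.
  obtain ⟨q, hq, hqs, hqd⟩ := Fintype.exists_disjointed_le (fun i => (⟨c i, hcL i⟩ : L))
  have hqc : ∀ i, (q i : A) ≤ c i := fun i => hq i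
  have hqx : ∀ x : A, (∀ i, (q i : A) ≤ x) → ∀ i, c i ≤ x := fun x hx i => by
    have h1 : (⟨c i, hcL i⟩ : L) ≤ Finset.univ.sup q := by
      rw [hqs]
      exact Finset.le_sup (f := fun i => (⟨c i, hcL i⟩ : L)) (Finset.mem_univ i)
    have h2 : ((Finset.univ.sup q : L) : A) ≤ x :=
      Finset.sup_induction (p := fun z : L => (z : A) ≤ x) bot_le
        (fun _ h _ h' => sup_le h h') fun i _ => hx i
    exact le_trans (show c i ≤ ((Finset.univ.sup q : L) : A) from h1) h2
  have hmy : ∀ i, Disjoint (maxPart (b i)) y := fun i =>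
    disjoint_compl_right.mono_left
      (Finset.le_sup (f := fun i => maxPart (b i)) (Finset.mem_univ i))
  refine ⟨fun i => maxPart (b i) ⊔ (y ⊓ q i), fun i => L.supClosed (maxPart_mem hL _)
    (L.infClosed hyL (q i).2), fun i j hij => ?_, fun x hx => hc x fun i => ?_,
    fun i => le_sup_left, fun i => ?_, fun d hdF i => ⟨fun h => ?_, fun h => ?_⟩⟩
  · have h1 : Disjoint (q i : A) (q j : A) := by
      have := hqd hij
      rw [Function.onFun, disjoint_iff] at this
      exact disjoint_iff.2 (congrArg Subtype.val this)
    refine Disjoint.sup_left (Disjoint.sup_right ?_ ?_) (Disjoint.sup_right ?_ ?_)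
    · exact (hd i j hij).mono (maxPart_le _) (maxPart_le _)
    · exact (hmy i).mono_right inf_le_left
    · exact (hmy j).symm.mono_left inf_le_left
    · exact h1.mono inf_le_right inf_le_right
  · have hyx : y ≤ x := by
      have h1 : ∀ i, c i ≤ yᶜ ⊔ x := hqx _ fun i => by
        rw [sup_comm, ← himp_eq, le_himp_iff, inf_comm]
        exact le_sup_right.trans (hx i)
      have h2 : yᶜ ⊔ x = ⊤ := by
        refine hc _ fun i => ?_
        -- Outside its maximal part, `b i` lies below `◇(b i)`.
        have h3 : b i ≤ maxPart (b i) ⊔ c i := by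
          rw [maxPart, hcdef]
          have : b i ≤ F.inf (t i) := Finset.le_inf (hbt i)
          calc b i = b i ⊓ box (b i)ᶜ ⊔ b i ⊓ (box (b i)ᶜ)ᶜ := by
                rw [← inf_sup_left, sup_compl_eq_top, inf_top_eq]
            _ ≤ _ := sup_le_sup_left (le_inf inf_le_right (inf_le_left.trans this)) _
        exact h3.trans (sup_le ((le_sup_left.trans (hx i)).trans le_sup_right) (h1 i))
      rw [sup_comm, ← himp_eq, himp_eq_top_iff] at h2
      exact h2
    have hyc : yᶜ ≤ x := by
      rw [hy, compl_compl]
      exact Finset.sup_le fun i _ => le_sup_left.trans (hx i)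
    have : (⊤ : A) ≤ x := by
      rw [← sup_compl_eq_top (x := y)]
      exact sup_le hyx hyc
    exact le_top.trans this
  · exact sup_le_sup (maxPart_le _) (inf_le_right.trans ((hqc i).trans inf_le_left))
  · refine sup_le ((maxPart_le _).trans h) (inf_le_right.trans ((hqc i).trans ?_))
    refine inf_le_right.trans ((Finset.inf_le hdF).trans ?_)
    simp only [ht, if_pos h, le_refl]
  -- An empty cell lies on both sides of `box d` and `t` picks the wrong one; but then `c i = ⊥`.
  · by_cases hb : b i = ⊥
    · have : c i = ⊥ := by
        simp only [hcdef, hb, compl_bot, ModalAlgebra.box_top, compl_top, bot_inf_eq]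
      have h1 : maxPart (b i) = ⊥ := le_bot_iff.1 ((maxPart_le _).trans hb.le)
      have h2 : (q i : A) = ⊥ := le_bot_iff.1 ((hqc i).trans this.le)
      simp only [h1, h2, inf_bot_eq, sup_idem, disjoint_bot_left]
    · have hn : ¬ b i ≤ box d := fun h' => hb (disjoint_self.1 (h.mono_right h'))
      refine Disjoint.sup_left (h.mono_left (maxPart_le _))
        (Disjoint.mono_left (inf_le_right.trans ((hqc i).trans
          (inf_le_right.trans (Finset.inf_le hdF)))) ?_)
      simp only [ht, if_neg hn]
      exact disjoint_compl_left

end Maximal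

/-! ### Partial embeddings -/

/-- `h` is injective on `F` and preserves the modal operations at arguments from `F`. -/
structure PreservesOn {A : Type u} {B : Type v} [ModalAlgebra A] [ModalAlgebra B] (F : Set A)
    (h : A → B) : Prop where
  inj : Set.InjOn h F
  map_inf : ∀ a ∈ F, ∀ b ∈ F, h (a ⊓ b) = h a ⊓ h b
  map_sup : ∀ a ∈ F, ∀ b ∈ F, h (a ⊔ b) = h a ⊔ h b
  map_compl : ∀ a ∈ F, h aᶜ = (h a)ᶜ
  map_box : ∀ a ∈ F, h (box a) = box (h a)
  map_bot : h ⊥ = ⊥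
  map_top : h ⊤ = ⊤

theorem PreservesOn.mono {A : Type u} {B : Type v} [ModalAlgebra A] [ModalAlgebra B]
    {F G : Set A} {h : A → B} (hG : PreservesOn G h) (hFG : F ⊆ G) : PreservesOn F h where
  inj := hG.inj.mono hFG
  map_inf a ha b hb := hG.map_inf a (hFG ha) b (hFG hb)
  map_sup a ha b hb := hG.map_sup a (hFG ha) b (hFG hb)
  map_compl a ha := hG.map_compl a (hFG ha)
  map_box a ha := hG.map_box a (hFG ha)
  map_bot := hG.map_bot
  map_top := hG.map_top

/-- Every finite part of `A` embeds into `B`. -/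
def LocallyEmbeds (A : Type u) (B : Type v) [ModalAlgebra A] [ModalAlgebra B] : Prop :=
  ∀ F : Set A, F.Finite → ∃ h : A → B, PreservesOn F h

theorem exists_preservesOn_mem {A : Type u} [MagariAlgebra A] {L : BooleanSubalgebra A}
    (hL : ∀ a, boxPlus a = a → a ∈ L) (F : Set A) (hfin : F.Finite) :
    ∃ h : A → A, PreservesOn F h ∧ ∀ a, h a ∈ L := by
  classical
  lift F to Finset A using hfin
  obtain ⟨ι, _, b, hd, hc, hG⟩ := exists_partition_deciding (F ∪ F.image box)
  have hFb : ∀ d ∈ F, ∀ i, b i ≤ box d ∨ Disjoint (b i) (box d) := fun d hdF =>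
    hG _ (Finset.mem_union_right _ (Finset.mem_image_of_mem _ hdF))
  have hF : ∀ d ∈ F, ∀ i, b i ≤ d ∨ Disjoint (b i) d := fun d hdF =>
    hG _ (Finset.mem_union_left _ hdF)
  obtain ⟨p, hpL, hpd, hpc, hmp, hpb, hpF⟩ := exists_skeletal_partition hL hd hc F hFb
  have hp0 : ∀ i, b i = ⊥ → p i = ⊥ := fun i hi => by
    have := hpb i
    rw [hi, compl_bot, ModalAlgebra.box_top, compl_top, sup_idem] at this
    exact le_bot_iff.1 this
  have hp0' : ∀ i, p i = ⊥ → b i = ⊥ := fun i hi =>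
    maxPart_eq_bot (le_bot_iff.1 ((hmp i).trans hi.le))
  set h : A → A := fun a => Finset.univ.sup fun i => if b i ≤ a then p i else ⊥ with hh
  -- With `hext` below, this lets every identity about `h` be checked cell by cell.
  have hph : ∀ i a, p i ⊓ h a = if b i ≤ a then p i else ⊥ := fun i a => by
    refine le_antisymm ?_ ?_
    · rw [hh, Finset.sup_inf_distrib_left]
      refine Finset.sup_le fun j _ => ?_
      by_cases hij : i = j
      · subst hij
        exact inf_le_right
      · refine le_trans ?_ bot_le
        refine ((hpd i j hij).mono_right ?_).le_bot
        split_ifs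
        exacts [le_rfl, bot_le]
    · refine le_inf ?_ (Finset.le_sup (f := fun i => if b i ≤ a then p i else ⊥)
        (Finset.mem_univ i))
      split_ifs
      exacts [le_rfl, bot_le]
  have hext : ∀ x y : A, (∀ i, p i ⊓ x = p i ⊓ y) → x = y := by
    have key : ∀ x y : A, (∀ i, p i ⊓ x = p i ⊓ y) → x ≤ y := fun x y hxy => by
      rw [← himp_eq_top_iff]
      refine hpc _ fun i => ?_
      rw [le_himp_iff, hxy]
      exact inf_le_right
    exact fun x y hxy => le_antisymm (key x y hxy) (key y x fun i => (hxy i).symm)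
  have hbox : ∀ d ∈ F, box (h d) = box d := fun d hdF => by
    -- Meets rather than joins, because `box` commutes with finite meets; it then only meets
    -- complements of cells, where `b i` and `p i` agree.
    have e1 : d = Finset.univ.inf fun i => if b i ≤ d then ⊤ else (b i)ᶜ := by
      refine le_antisymm (Finset.le_inf fun i _ => ?_) ?_
      · split_ifs with hi
        · exact le_top
        · exact ((hF d hdF i).resolve_left hi).symm.le_compl_right
      · rw [← himp_eq_top_iff]
        refine hc _ fun i => ?_
        rw [le_himp_iff]
        refine (inf_le_inf_left _ (Finset.inf_le (Finset.mem_univ i))).trans ?_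
        split_ifs with hi
        · exact inf_le_left.trans hi
        · rw [inf_compl_self]; exact bot_le
    have e2 : h d = Finset.univ.inf fun i => if b i ≤ d then ⊤ else (p i)ᶜ := by
      refine le_antisymm (Finset.le_inf fun i _ => ?_) ?_
      · split_ifs with hi
        · exact le_top
        · have := hph i d
          rw [if_neg hi] at this
          exact (disjoint_iff.2 this).symm.le_compl_right
      · rw [← himp_eq_top_iff]
        refine hpc _ fun i => ?_
        rw [le_himp_iff]
        refine (inf_le_inf_left _ (Finset.inf_le (Finset.mem_univ i))).trans ?_
        have := hph i d
        split_ifs with hi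
        · rw [if_pos hi] at this
          rw [inf_top_eq, ← this]
          exact inf_le_right
        · rw [inf_compl_self]; exact bot_le
    have hinf : ∀ f : ι → A, box (Finset.univ.inf f) = Finset.univ.inf fun i => box (f i) :=
      fun f => Finset.apply_inf_eq_inf_comp box ModalAlgebra.box_inf ModalAlgebra.box_top
    rw [e2]
    conv_rhs => rw [e1]
    rw [hinf, hinf]
    refine Finset.inf_congr rfl fun i _ => ?_
    split_ifs
    · rfl
    · exact box_compl_eq_of_le (hmp i) (hpb i)
  refine ⟨h, ⟨?_, ?_, ?_, ?_, ?_, ?_, ?_⟩, fun a => finset_sup_mem _ _ _ fun i _ => ?_⟩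
  · have key : ∀ a ∈ F, ∀ c ∈ F, h a = h c → a ≤ c := fun a ha c hcF hac => by
      rw [← himp_eq_top_iff]
      refine hc _ fun i => ?_
      rw [le_himp_iff]
      rcases hF a ha i with hi | hi
      · have h1 := hph i a
        have h2 := hph i c
        rw [hac, if_pos hi, h2] at h1
        split_ifs at h1 with h3
        · exact inf_le_left.trans h3
        · rw [hp0' i h1.symm, bot_inf_eq]; exact bot_le
      · exact hi.le_bot.trans bot_le
    exact fun a ha c hcF hac => le_antisymm (key a ha c hcF hac) (key c hcF a ha hac.symm)
  · refine fun a _ c _ => hext _ _ fun i => ?_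
    rw [inf_inf_distrib_left, hph, hph, hph]
    by_cases h1 : b i ≤ a <;> by_cases h2 : b i ≤ c <;> simp [h1, h2]
  · refine fun a ha c hcF => hext _ _ fun i => ?_
    rw [inf_sup_left, hph, hph, hph]
    rcases hF a ha i with h1 | h1
    · rw [if_pos (h1.trans le_sup_left), if_pos h1]
      exact (sup_eq_left.2 (by split_ifs; exacts [le_rfl, bot_le])).symm
    · rcases hF c hcF i with h2 | h2
      · rw [if_pos (h2.trans le_sup_right), if_pos h2]
        exact (sup_eq_right.2 (by split_ifs; exacts [le_rfl, bot_le])).symm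
      · by_cases hb : b i = ⊥
        · simp [hp0 i hb]
        · have n1 : ¬ b i ≤ a := fun h' => hb (disjoint_self.1 (h1.mono_right h'))
          have n2 : ¬ b i ≤ c := fun h' => hb (disjoint_self.1 (h2.mono_right h'))
          have n3 : ¬ b i ≤ a ⊔ c := fun h' =>
            hb (disjoint_self.1 ((h1.sup_right h2).mono_right h'))
          rw [if_neg n1, if_neg n2, if_neg n3, sup_idem]
  · refine fun a ha => hext _ _ fun i => ?_
    have h2 : p i ⊓ (h a)ᶜ = p i \ (p i ⊓ h a) := by rw [sdiff_inf_self_left, sdiff_eq]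
    rw [h2, hph, hph]
    by_cases hb : b i = ⊥
    · simp [hp0 i hb]
    · rcases hF a ha i with h1 | h1
      · have n1 : ¬ b i ≤ aᶜ := fun h' =>
          hb (le_bot_iff.1 ((le_inf h1 h').trans inf_compl_eq_bot.le))
        rw [if_neg n1, if_pos h1, sdiff_self]
      · have n1 : ¬ b i ≤ a := fun h' => hb (disjoint_self.1 (h1.mono_right h'))
        rw [if_neg n1, if_pos h1.le_compl_right, sdiff_bot]
  · intro a ha
    rw [hbox a ha]
    -- It remains to see that `h` fixes `box a`: each `p i` is on the same side of it as `b i`.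
    refine hext _ _ fun i => ?_
    rw [hph]
    split_ifs with hi
    · exact (inf_eq_left.2 ((hpF a ha i).1 hi)).symm
    · exact (((hpF a ha i).2 ((hFb a ha i).resolve_left hi)).eq_bot).symm
  · refine hext _ _ fun i => ?_
    rw [hph, inf_bot_eq]
    split_ifs with hi
    · exact hp0 i (le_bot_iff.1 hi)
    · rfl
  · refine hext _ _ fun i => ?_
    rw [hph, if_pos le_top, inf_top_eq]
  · split_ifs
    exacts [hpL i, BooleanSubalgebra.bot_mem]

/-! ### Transfer of universal formulae and rules -/

section Transfer

open FirstOrder Language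

variable {A : Type u} {B : Type v} [ModalAlgebra A] [ModalAlgebra B]

theorem exists_finite_term_realize {α : Type} (v : α → A) (t : md.Term α) :
    ∃ F : Set A, F.Finite ∧ ∀ h : A → B, PreservesOn F h →
      h (t.realize v) = t.realize (h ∘ v) := by
  induction t with
  | var x => exact ⟨∅, Set.finite_empty, fun h _ => rfl⟩
  | @func n f ts ih =>
    choose F hfin hF using ih
    refine ⟨(⋃ i, F i) ∪ Set.range fun i => (ts i).realize v,
      (Set.finite_iUnion hfin).union (Set.finite_range _), fun h hh => ?_⟩
    have key : (fun i => (ts i).realize (h ∘ v)) = fun i => h ((ts i).realize v) :=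
      funext fun i => (hF i h (hh.mono ((Set.subset_iUnion F i).trans
        Set.subset_union_left))).symm
    have hmem : ∀ i, (ts i).realize v ∈ (⋃ i, F i) ∪ Set.range fun i => (ts i).realize v :=
      fun i => Or.inr ⟨i, rfl⟩
    change h (interpOp f fun i => (ts i).realize v) = interpOp f fun i => (ts i).realize (h ∘ v)
    rw [key]
    cases f with
    | and => exact hh.map_inf _ (hmem _) _ (hmem _)
    | or => exact hh.map_sup _ (hmem _) _ (hmem _)
    | neg => exact hh.map_compl _ (hmem _)
    | box => exact hh.map_box _ (hmem _)
    | bot => exact hh.map_bot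
    | top => exact hh.map_top

theorem exists_finite_realize_iff {α : Type} {n : ℕ} {φ : md.BoundedFormula α n} (hφ : φ.IsQF)
    (v : α → A) (xs : Fin n → A) :
    ∃ F : Set A, F.Finite ∧ ∀ h : A → B, PreservesOn F h →
      (φ.Realize v xs ↔ φ.Realize (h ∘ v) (h ∘ xs)) := by
  induction hφ with
  | falsum => exact ⟨∅, Set.finite_empty, fun h _ => Iff.rfl⟩
  | of_isAtomic hat =>
    cases hat with
    | equal s t =>
      obtain ⟨F, hF, hs⟩ := exists_finite_term_realize (B := B) (Sum.elim v xs) s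
      obtain ⟨G, hG, ht⟩ := exists_finite_term_realize (B := B) (Sum.elim v xs) t
      -- With both sides of the equation included, injectivity reflects it back to `A`.
      refine ⟨F ∪ G ∪ {s.realize (Sum.elim v xs), t.realize (Sum.elim v xs)},
        (hF.union hG).union (Set.toFinite _), fun h hh => ?_⟩
      rw [BoundedFormula.realize_bdEqual, BoundedFormula.realize_bdEqual, ← Sum.comp_elim,
        ← hs h (hh.mono fun x hx => Or.inl (Or.inl hx)),
        ← ht h (hh.mono fun x hx => Or.inl (Or.inr hx))]
      exact (hh.inj.eq_iff (Or.inr (Or.inl rfl)) (Or.inr (Or.inr rfl))).symm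
    | rel R => exact R.elim
  | imp _ _ ih₁ ih₂ =>
    obtain ⟨F, hF, h₁⟩ := ih₁
    obtain ⟨G, hG, h₂⟩ := ih₂
    refine ⟨F ∪ G, hF.union hG, fun h hh => ?_⟩
    rw [BoundedFormula.realize_imp, BoundedFormula.realize_imp,
      h₁ h (hh.mono Set.subset_union_left), h₂ h (hh.mono Set.subset_union_right)]

theorem LocallyEmbeds.realize_of_isUniversal (hAB : LocallyEmbeds A B) {α : Type} {n : ℕ}
    {φ : md.BoundedFormula α n} (hφ : φ.IsUniversal)
    (hB : ∀ (v : α → B) (xs : Fin n → B), φ.Realize v xs) (v : α → A) (xs : Fin n → A) :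
    φ.Realize v xs := by
  induction hφ with
  | of_isQF hq =>
    obtain ⟨F, hF, h⟩ := exists_finite_realize_iff (B := B) hq v xs
    obtain ⟨f, hf⟩ := hAB F hF
    exact (h f hf).2 (hB _ _)
  | all _ ih =>
    intro x
    refine ih (fun v xs => ?_) (Fin.snoc xs x)
    -- Every tuple extends its initial segment, so validity of `∀'φ` at all tuples gives validity of
    -- `φ` at all tuples.
    have := hB v (Fin.init xs) (xs (Fin.last _))
    rwa [Fin.snoc_init_self] at this

theorem LocallyEmbeds.models (hAB : LocallyEmbeds A B) {T : md.Theory} (hT : T.IsUniversal)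
    (hB : B ⊨ T) : A ⊨ T := by
  rw [Theory.model_iff] at hB ⊢
  refine fun φ hφ => hAB.realize_of_isUniversal (hT.isUniversal_of_mem hφ) (fun v xs => ?_) _ _
  have := hB φ hφ
  rw [Sentence.Realize, Formula.Realize] at this
  convert this using 1

end Transfer

theorem LocallyEmbeds.mem {A B : Mag.{u}} (h : LocallyEmbeds A.carrier B.carrier)
    {U : Set Mag.{u}} (hU : IsUniversalClass U) (hB : B ∈ U) : A ∈ U := by
  obtain ⟨T, hT, rfl⟩ := hU
  exact h.models hT hB

theorem LocallyEmbeds.valid {A B : Mag.{u}} (h : LocallyEmbeds A.carrier B.carrier) {r : MdRule}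
    (hB : Valid B r) : Valid A r := by
  classical
  intro V hV
  choose F hF hFV using exists_finite_term_realize (B := B.carrier) V
  -- Including `⊤` and the values of all formulae makes `f` reflect, not only preserve, having value
  -- `⊤`.
  obtain ⟨f, hf⟩ := h ((⋃ t ∈ r.premises ∪ r.conclusions, F t ∪ {t.realize V}) ∪ {⊤})
    (((Finset.finite_toSet _).biUnion fun t _ => (hF t).union (Set.finite_singleton _)).union
      (Set.finite_singleton _))
  have hsub : ∀ t ∈ r.premises ∪ r.conclusions, F t ∪ {t.realize V} ⊆
      (⋃ t ∈ r.premises ∪ r.conclusions, F t ∪ {t.realize V}) ∪ {⊤} := fun t ht =>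
    (Set.subset_biUnion_of_mem (u := fun t => F t ∪ {t.realize V})
      (Finset.mem_coe.2 ht)).trans Set.subset_union_left
  have key : ∀ t ∈ r.premises ∪ r.conclusions,
      (t.realize (f ∘ V) = ⊤ ↔ t.realize V = ⊤) := fun t ht => by
    rw [← hFV t f (hf.mono (Set.subset_union_left.trans (hsub t ht))), ← hf.map_top]
    exact hf.inj.eq_iff (hsub t ht (Or.inr rfl)) (Or.inr rfl)
  obtain ⟨δ, hδ, h'⟩ := hB (f ∘ V) fun γ hγ =>
    (key γ (Finset.mem_union_left _ hγ)).2 (hV γ hγ)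
  exact ⟨δ, hδ, (key δ (Finset.mem_union_right _ hδ)).1 h'⟩

theorem locallyEmbeds_of_injective {A : Type u} {B : Type v} [ModalAlgebra A] [ModalAlgebra B]
    (f : BoundedLatticeHom A B) (hf : Function.Injective f) (hbox : ∀ a, f (box a) = box (f a)) :
    LocallyEmbeds A B := fun _ _ =>
  ⟨f, hf.injOn, fun a _ b _ => map_inf f a b, fun a _ b _ => map_sup f a b,
    fun a _ => map_compl' f a, fun a _ => hbox a, map_bot f, map_top f⟩

theorem Mag.Iso.locallyEmbeds {A B : Mag.{u}} (h : A.Iso B) :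
    LocallyEmbeds A.carrier B.carrier := by
  obtain ⟨e, he⟩ := h
  exact fun _ _ => ⟨e, e.injective.injOn, fun a _ b _ => map_inf e a b,
    fun a _ b _ => map_sup e a b, fun a _ => map_compl' e a, fun a _ => he a, map_bot e,
    map_top e⟩

theorem Mag.Iso.symm {A B : Mag.{u}} (h : A.Iso B) : B.Iso A := by
  obtain ⟨e, he⟩ := h
  refine ⟨e.symm, fun a => e.injective ?_⟩
  rw [he, e.apply_symm_apply, e.apply_symm_apply]

/-! ### The universal property of the free Boolean extension -/

theorem emb_sup {H : Type u} [HeytingAlgebra H] (a b : H) : emb (a ⊔ b) = emb a ⊔ emb b :=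
  Subtype.ext (stone_sup a b)

theorem emb_bot {H : Type u} [HeytingAlgebra H] : emb (⊥ : H) = ⊥ := Subtype.ext stone_bot

theorem isSublattice_range_stone (H : Type u) [HeytingAlgebra H] :
    IsSublattice (Set.range (stone (H := H))) := by
  refine ⟨?_, ?_⟩
  · rintro _ ⟨a, rfl⟩ _ ⟨b, rfl⟩
    exact ⟨a ⊔ b, stone_sup a b⟩
  · rintro _ ⟨a, rfl⟩ _ ⟨b, rfl⟩
    exact ⟨a ⊓ b, stone_inf a b⟩

theorem FreeBoolExt.induction {H : Type u} [HeytingAlgebra H] {P : FreeBoolExt H → Prop}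
    (sdiff : ∀ a b, P (emb a \ emb b)) (sup : ∀ x y, P x → P y → P (x ⊔ y))
    (x : FreeBoolExt H) : P x := by
  obtain ⟨s, hs⟩ := x
  induction s, hs using BooleanSubalgebra.closure_sdiff_sup_induction
    (isSublattice_range_stone H) ⟨⊥, stone_bot⟩ ⟨⊤, stone_top⟩ with
  | sdiff x hx y hy =>
    obtain ⟨a, rfl⟩ := hx
    obtain ⟨c, rfl⟩ := hy
    exact sdiff a c
  | sup x hx y hy ihx ihy => exact sup _ _ ihx ihy

section Lift

variable {H : Type u} [HeytingAlgebra H] {C : Type u} [BooleanAlgebra C]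

/-- The map on prime ideals dual to a homomorphism of bounded lattices. -/
def PrimeIdeals.comap (f : BoundedLatticeHom H C) (I : PrimeIdeals C) : PrimeIdeals H :=
  let J : Order.Ideal H := Order.IsIdeal.toIdeal (I := {a | f a ∈ I.1}) ⟨
      fun _ _ hba ha => I.1.lower (OrderHomClass.mono f hba) ha,
      ⟨⊥, by simp⟩,
      fun a ha b hb => ⟨a ⊔ b, by
        change f (a ⊔ b) ∈ I.1
        rw [map_sup]
        exact Order.Ideal.sup_mem ha hb, le_sup_left, le_sup_right⟩⟩
  ⟨J, by
    have hJ : J.IsProper := Order.Ideal.isProper_of_notMem (p := ⊤) fun h => by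
      have h1 : f ⊤ ∈ I.1 := h
      rw [map_top] at h1
      exact I.2.toIsProper.top_notMem h1
    refine Order.Ideal.IsPrime.of_mem_or_mem fun {x y} hxy => ?_
    have h1 : f (x ⊓ y) ∈ I.1 := hxy
    rw [map_inf] at h1
    exact I.2.mem_or_mem h1⟩

theorem stone_injective : Function.Injective (stone (H := H)) := fun _ _ h =>
  le_antisymm (stone_le_stone.1 h.le) (stone_le_stone.1 h.ge)

theorem emb_injective : Function.Injective (emb (H := H)) := fun _ _ h =>
  stone_injective (congrArg Subtype.val h)

/-- Preimage under the dual map takes `stone a` to `stone (f a)`, and complements stay representable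
because `C` is Boolean. This gives the lift without choosing normal forms. -/
theorem exists_comap_preimage_eq_stone (f : BoundedLatticeHom H C) (x : FreeBoolExt H) :
    ∃ c : C, stone c = PrimeIdeals.comap f ⁻¹' x.1 := by
  induction x using FreeBoolExt.induction with
  | sdiff a b =>
    have hcompl : stone (f b)ᶜ = (stone (f b))ᶜ := by
      refine eq_compl_iff_isCompl.2 (IsCompl.of_eq ?_ ?_)
      · rw [← stone_inf, compl_inf_eq_bot, stone_bot]
      · rw [← stone_sup, compl_sup_eq_top, stone_top]
    exact ⟨f a ⊓ (f b)ᶜ, by rw [stone_inf, hcompl]; rfl⟩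
  | sup x y hx hy =>
    obtain ⟨c, hc⟩ := hx
    obtain ⟨d, hd⟩ := hy
    exact ⟨c ⊔ d, by rw [stone_sup, hc, hd]; rfl⟩

/-- The extension of a homomorphism of bounded lattices from `H` to a Boolean algebra along the
embedding of `H` into its free Boolean extension. -/
noncomputable def FreeBoolExt.lift (f : BoundedLatticeHom H C) :
    BoundedLatticeHom (FreeBoolExt H) C :=
  have h := fun x => (exists_comap_preimage_eq_stone f x).choose_spec
  { toFun := fun x => (exists_comap_preimage_eq_stone f x).choose
    map_sup' := fun x y => stone_injective <| by rw [h, stone_sup, h, h]; rfl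
    map_inf' := fun x y => stone_injective <| by rw [h, stone_inf, h, h]; rfl
    map_top' := stone_injective <| by rw [h, stone_top]; rfl
    map_bot' := stone_injective <| by rw [h, stone_bot]; rfl }

theorem FreeBoolExt.lift_emb (f : BoundedLatticeHom H C) (a : H) :
    FreeBoolExt.lift f (emb a) = f a :=
  stone_injective (exists_comap_preimage_eq_stone f (emb a)).choose_spec

/-- Every element is a finite join of differences `emb a \ emb b`, and such a difference vanishes
exactly when `a ≤ b`, which an injective `f` reflects. -/
theorem FreeBoolExt.lift_injective {f : BoundedLatticeHom H C} (hf : Function.Injective f) :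
    Function.Injective (FreeBoolExt.lift f) := by
  have key : ∀ x, FreeBoolExt.lift f x = ⊥ → x = ⊥ := fun x => by
    induction x using FreeBoolExt.induction with
    | sdiff a b =>
      rw [map_sdiff', sdiff_eq_bot_iff, sdiff_eq_bot_iff, lift_emb, lift_emb, emb_le_emb]
      intro h
      rwa [← inf_eq_left, ← hf.eq_iff, map_inf, inf_eq_left]
    | sup x y hx hy =>
      rw [map_sup, sup_eq_bot_iff, sup_eq_bot_iff]
      exact fun h => ⟨hx h.1, hy h.2⟩
  have hle : ∀ x y, FreeBoolExt.lift f x ≤ FreeBoolExt.lift f y → x ≤ y := fun x y h => by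
    rw [← sdiff_eq_bot_iff] at h ⊢
    exact key _ (by rw [map_sdiff', h])
  exact fun x y h => le_antisymm (hle _ _ h.le) (hle _ _ h.ge)

end Lift

/-! ### Recognising skeletal algebras -/

section Skeleton

variable {H : Type u} [Fronton H] {C : Type u} [MagariAlgebra C]

theorem box_boxPlus (a : C) : box (boxPlus a) = box a := by
  rw [boxPlus, ModalAlgebra.box_inf]
  exact inf_eq_right.2 (box_le_box_box a)

/-- The lift carries the interior of `x` to the greatest open below its image, which is `□⁺` of it;
and `□` does not distinguish an element from its `□⁺`. -/
theorem lift_box {f : BoundedLatticeHom H C} (hf : Function.Injective f)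
    (hopen : ∀ c, boxPlus c = c ↔ c ∈ Set.range f) (hbox : ∀ a, f (bx a) = box (f a))
    (x : FreeBoolExt H) : FreeBoolExt.lift f (box x) = box (FreeBoolExt.lift f x) := by
  have hinj := FreeBoolExt.lift_injective hf
  have hle : ∀ x y, FreeBoolExt.lift f x ≤ FreeBoolExt.lift f y ↔ x ≤ y := fun x y => by
    rw [← inf_eq_left, ← map_inf, hinj.eq_iff, inf_eq_left]
  obtain ⟨h, hh⟩ := (hopen _).1 (Opens.boxPlus_open (FreeBoolExt.lift f x))
  have hint : interior x = h := eq_of_forall_le_iff fun b => by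
    rw [le_interior_iff, ← hle, FreeBoolExt.lift_emb,
      ← Opens.le_boxPlus_iff ((hopen (f b)).2 ⟨b, rfl⟩), ← hh, ← FreeBoolExt.lift_emb f b,
      ← FreeBoolExt.lift_emb f h, hle, emb_le_emb]
  change FreeBoolExt.lift f (emb (bx (interior x))) = _
  rw [FreeBoolExt.lift_emb, hbox, hint, hh, box_boxPlus]

theorem exists_orderIso_of_closure_eq_top {f : BoundedLatticeHom H C}
    (hf : Function.Injective f) (hopen : ∀ c, boxPlus c = c ↔ c ∈ Set.range f)
    (hbox : ∀ a, f (bx a) = box (f a))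
    (hgen : BooleanSubalgebra.closure (Set.range f) = ⊤) :
    ∃ e : FreeBoolExt H ≃o C, ∀ a, e (box a) = box (e a) := by
  have hinj := FreeBoolExt.lift_injective hf
  have hsurj : Function.Surjective (FreeBoolExt.lift f) := fun c => by
    have h1 : BooleanSubalgebra.closure (Set.range f) ≤
        BooleanSubalgebra.map (FreeBoolExt.lift f) ⊤ := by
      rw [BooleanSubalgebra.closure_le]
      rintro _ ⟨a, rfl⟩
      exact ⟨emb a, trivial, FreeBoolExt.lift_emb f a⟩
    have h2 : c ∈ BooleanSubalgebra.closure (Set.range f) := hgen ▸ BooleanSubalgebra.mem_top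
    obtain ⟨x, -, hx⟩ := h1 h2
    exact ⟨x, hx⟩
  refine ⟨⟨Equiv.ofBijective _ ⟨hinj, hsurj⟩, fun {x y} => ?_⟩, lift_box hf hopen hbox⟩
  change FreeBoolExt.lift f x ≤ FreeBoolExt.lift f y ↔ x ≤ y
  rw [← inf_eq_left, ← map_inf, hinj.eq_iff, inf_eq_left]

/-- The inclusion of `ρC` in `C`. -/
def Opens.val : BoundedLatticeHom (Opens C) C where
  toFun a := a.1
  map_sup' _ _ := rfl
  map_inf' _ _ := rfl
  map_top' := rfl
  map_bot' := rfl

theorem Opens.val_injective : Function.Injective (Opens.val (C := C)) := Subtype.val_injective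

theorem Opens.mem_range_val (c : C) : boxPlus c = c ↔ c ∈ Set.range (Opens.val (C := C)) :=
  ⟨fun h => ⟨⟨c, h⟩, rfl⟩, by rintro ⟨a, rfl⟩; exact a.2⟩

/-- This is where `⊠a ≤ b ∨ (b → a)` enters. Complements are used because interiors commute with
meets, which leaves only the complement of one difference. -/
theorem box_inf_le_emb_interior (x : FreeBoolExt H) : box x ⊓ x ≤ emb (interior x) := by
  suffices h : ∀ y : FreeBoolExt H, box yᶜ ⊓ yᶜ ≤ emb (interior yᶜ) by
    have := h xᶜ
    rwa [compl_compl] at this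
  intro y
  induction y using FreeBoolExt.induction with
  | sdiff b c =>
    have hi : interior (emb b \ emb c)ᶜ = b ⇨ c := eq_of_forall_le_iff fun d => by
      rw [le_interior_iff, compl_sdiff, le_himp_iff, ← emb_inf, emb_le_emb, le_himp_iff]
    -- The axiom for `a = b ⇨ c`, as `b ⇨ (b ⇨ c) = b ⇨ c`. Meeting with the Boolean implication
    -- turns the disjunct `b` into `c`.
    have h1 : bx (b ⇨ c) ≤ b ⊔ (b ⇨ c) := by
      have := Fronton.bx_le (b ⇨ c) b
      rwa [himp_idem] at this
    change emb (bx (interior (emb b \ emb c)ᶜ)) ⊓ _ ≤ _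
    rw [hi, compl_sdiff]
    refine (inf_le_inf_right _ (emb_le_emb.2 h1)).trans ?_
    rw [emb_sup, inf_sup_right]
    refine sup_le (inf_himp_le.trans (emb_le_emb.2 le_himp)) inf_le_left
  | sup x y hx hy =>
    have hi : interior (x ⊔ y)ᶜ = interior xᶜ ⊓ interior yᶜ := eq_of_forall_le_iff fun b => by
      rw [le_inf_iff, le_interior_iff, le_interior_iff, le_interior_iff, compl_sup, le_inf_iff]
    rw [hi, emb_inf, compl_sup, ModalAlgebra.box_inf]
    refine le_inf (le_trans ?_ hx) (le_trans ?_ hy)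
    · exact inf_le_inf inf_le_left inf_le_left
    · exact inf_le_inf inf_le_right inf_le_right

theorem emb_bx (a : H) : emb (bx a) = box (emb a) := by
  have : interior (emb a) = a := eq_of_forall_le_iff fun b => by
    rw [le_interior_iff, emb_le_emb]
  change _ = emb (bx (interior (emb a)))
  rw [this]

theorem boxPlus_eq_iff_mem_range_emb (x : FreeBoolExt H) :
    boxPlus x = x ↔ x ∈ Set.range (emb (H := H)) := by
  refine ⟨fun h => ⟨interior x, le_antisymm (le_interior_iff.1 le_rfl) ?_⟩, ?_⟩
  · exact h.ge.trans (box_inf_le_emb_interior x)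
  · rintro ⟨a, rfl⟩
    rw [boxPlus_eq_iff, ← emb_bx, emb_le_emb]
    exact Fronton.le_bx a

theorem closure_range_emb : BooleanSubalgebra.closure (Set.range (emb (H := H))) = ⊤ := by
  refine top_le_iff.1 fun x _ => ?_
  induction x using FreeBoolExt.induction with
  | sdiff a b =>
    exact BooleanSubalgebra.sdiff_mem (BooleanSubalgebra.subset_closure ⟨a, rfl⟩)
      (BooleanSubalgebra.subset_closure ⟨b, rfl⟩)
  | sup x y hx hy => exact BooleanSubalgebra.supClosed _ (hx trivial) (hy trivial)

end Skeleton

/-! ### Skeletal algebras and the comparison of `A` with `σρA` -/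

theorem sigma_isSkeletal (H : Frt.{u}) : (sigma H).IsSkeletal := by
  refine exists_orderIso_of_closure_eq_top (H := Opens (FreeBoolExt H.carrier))
    (C := FreeBoolExt H.carrier) Opens.val_injective Opens.mem_range_val (fun _ => rfl) ?_
  have h : Set.range (Opens.val (C := FreeBoolExt H.carrier)) =
      Set.range (emb (H := H.carrier)) := Set.ext fun x =>
    (Opens.mem_range_val x).symm.trans (boxPlus_eq_iff_mem_range_emb x)
  rw [h, closure_range_emb]

theorem Frt.Iso.sigma {H K : Frt.{u}} (h : H.Iso K) : (sigma H).Iso (sigma K) := by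
  obtain ⟨e, he⟩ := h
  let f : BoundedLatticeHom H.carrier (FreeBoolExt K.carrier) :=
    { toFun := fun a => emb (e a)
      map_sup' := fun a b => by rw [map_sup, emb_sup]
      map_inf' := fun a b => by rw [map_inf, emb_inf]
      map_top' := by rw [map_top, emb_top]
      map_bot' := by rw [map_bot, emb_bot] }
  have hr : Set.range f = Set.range (emb (H := K.carrier)) := e.surjective.range_comp emb
  refine exists_orderIso_of_closure_eq_top (C := FreeBoolExt K.carrier) (f := f)
    (fun a b hab => e.injective (emb_injective hab)) (fun c => ?_) (fun a => ?_) ?_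
  · rw [hr, boxPlus_eq_iff_mem_range_emb]
  · change emb (e (bx a)) = box (emb (e a))
    rw [he, emb_bx]
  · rw [hr, closure_range_emb]

theorem freeBoolExt_opens_locallyEmbeds (A : Type u) [MagariAlgebra A] :
    LocallyEmbeds (FreeBoolExt (Opens A)) A :=
  locallyEmbeds_of_injective (FreeBoolExt.lift Opens.val)
    (FreeBoolExt.lift_injective Opens.val_injective)
    (lift_box Opens.val_injective Opens.mem_range_val fun _ => rfl)

theorem locallyEmbeds_freeBoolExt_opens (A : Type u) [MagariAlgebra A] :
    LocallyEmbeds A (FreeBoolExt (Opens A)) := by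
  intro F hF
  let j : BoundedLatticeHom (FreeBoolExt (Opens A)) A :=
    FreeBoolExt.lift Opens.val
  have hj : Function.Injective j := FreeBoolExt.lift_injective Opens.val_injective
  have hjb : ∀ x, j (box x) = box (j x) :=
    lift_box Opens.val_injective Opens.mem_range_val fun _ => rfl
  obtain ⟨h, hh, hL⟩ := exists_preservesOn_mem (L := BooleanSubalgebra.map j ⊤)
    (fun a ha => ⟨emb (⟨a, ha⟩ : Opens A), trivial, FreeBoolExt.lift_emb _ _⟩) F hF
  -- `h` takes values in the image of the embedding `j`, so it factors as `j ∘ g`; injectivity of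
  -- `j` moves each identity from `h` to `g`.
  choose g _ hg using hL
  refine ⟨g, ⟨fun a ha b hb hab => ?_, fun a ha b hb => hj ?_, fun a ha b hb => hj ?_,
    fun a ha => hj ?_, fun a ha => hj ?_, hj ?_, hj ?_⟩⟩
  · exact hh.inj ha hb (by rw [← hg, hab, hg])
  · rw [map_inf, hg, hg, hg, hh.map_inf a ha b hb]
  · rw [map_sup, hg, hg, hg, hh.map_sup a ha b hb]
  · rw [map_compl', hg, hg, hh.map_compl a ha]
  · rw [hjb, hg, hg, hh.map_box a ha]
  · rw [hg, map_bot, hh.map_bot]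
  · rw [hg, map_top, hh.map_top]

theorem sigma_rho_locallyEmbeds (A : Mag.{u}) :
    LocallyEmbeds (sigma (rho A)).carrier A.carrier :=
  freeBoolExt_opens_locallyEmbeds A.carrier

theorem locallyEmbeds_sigma_rho (A : Mag.{u}) :
    LocallyEmbeds A.carrier (sigma (rho A)).carrier :=
  locallyEmbeds_freeBoolExt_opens A.carrier

theorem sigma_rho_mem_iff {U : Set Mag.{u}} (hU : IsUniversalClass U) (A : Mag.{u}) :
    sigma (rho A) ∈ U ↔ A ∈ U :=
  ⟨(locallyEmbeds_sigma_rho A).mem hU, (sigma_rho_locallyEmbeds A).mem hU⟩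

end KM

/-- Every universal class of Magari algebras is generated by its skeletal elements, that is
`U = σρU`; and a Magari algebra `A` and its skeleton `σρA` validate the same modal rules. -/
theorem mainTheorem10 :
    (∀ U : Set KM.Mag.{u}, KM.IsUniversalClass U →
      KM.Uni {A : KM.Mag.{u} | A ∈ U ∧ A.IsSkeletal} = U ∧
      KM.sigmaClass (KM.rhoClass U) = U) ∧
    (∀ (A : KM.Mag.{u}) (r : KM.MdRule),
      KM.Valid A r ↔ KM.Valid (KM.sigma (KM.rho A)) r) := by
  refine ⟨fun U hU => ⟨Set.Subset.antisymm ?_ ?_, Set.Subset.antisymm ?_ ?_⟩, fun A r => ?_⟩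
  · exact fun A hA => hA U hU fun B hB => hB.1
  -- `σρA` is a skeletal member of `U`, hence in `W`, and membership in `W` passes back to `A`.
  · exact fun A hA W hW hKW => (KM.sigma_rho_mem_iff hW A).1
      (hKW ⟨(KM.sigma_rho_mem_iff hU A).2 hA, KM.sigma_isSkeletal _⟩)
  · refine fun A hA => hA U hU ?_
    rintro _ ⟨H, ⟨B, hB, hBH⟩, rfl⟩
    exact hBH.sigma.symm.locallyEmbeds.mem hU ((KM.sigma_rho_mem_iff hU B).2 hB)
  · exact fun A hA W hW hKW => (KM.sigma_rho_mem_iff hW A).1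
      (hKW ⟨KM.rho A, ⟨A, hA, OrderIso.refl _, fun _ => rfl⟩, rfl⟩)
  · exact ⟨(KM.sigma_rho_locallyEmbeds A).valid, (KM.locallyEmbeds_sigma_rho A).valid⟩
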